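/- For complex $\kappa,\mu,z$ with $2\mu\notin\{-1,-2,\dots\}$ let $$\mathrm M_{\kappa,\mu}(z)=z^{\mu+1/2}e^{-z/2}\,{}_1F_1\!\left(\tfrac12+\mu-\kappa;\,1+2\mu;\,z\right),\qquad {}_1F_1(a;b;z)=\sum_{k\ge0}\frac{(a)_k}{(b)_k}\frac{z^k}{k!},$$ be the Whittaker function (principal power), where $(a)_k=a(a+1)\cdots(a+k-1)$. Let $\gamma$ be Euler's constant, $H_n=\sum_{k=1}^n\frac1k$, let $$\mathrm{Ei}(x)=\mathrm{p.v.}\!\int_{-\infty}^{x}\frac{e^t}{t}\,dt\quad(x\in\mathbb R\setminus\{0\}),\qquad L_n^{(\alpha)}(x)=\sum_{m=0}^{n}\frac{\Gamma(n+\alpha+1)}{\Gamma(m+\alpha+1)}\frac{(-x)^m}{m!\,(n-m)!}$$ be the exponential integral and the Laguerre polynomials, and let ${}_2F_1(a,b;c;z)$ denote the principal branch of the Gauss hypergeometric function, i.e. the analytic continuation of $\sum_{k\ge0}\frac{(a)_k(b)_k}{(c)_k}\frac{z^k}{k!}$ ($|z|<1$) to $\mathbb C\setminus[1,\infty)$,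 with the value at a point $x\in[1,\infty)$ being the limit from the upper half-plane. (For real parameters the limit from the lower half-plane has the same real part.) **Theorem.** Let $n\ge1$ be an integer. For every real $x\ne0$, the function $\kappa\mapsto \mathrm M_{\kappa,1/2}(x)$ is (complex) differentiable at $\kappa=n$, and $$\left.\frac{\partial \mathrm M_{\kappa,\mu}(x)}{\partial\kappa}\right|_{\kappa=n,\,\mu=1/2}=\frac2n\sinh\frac x2+\frac{x\,e^{-x/2}}{n}\Bigg\{\Big[\ln|x|+\gamma-H_n-\mathrm{Ei}(x)\Big]L^{(1)}_{n-1}(x)+\sum_{\ell=1}^{n-1}\left(\frac{n+\ell}{n-\ell}-e^{x}\,\mathrm{Re}\big[{}_2F_1(1,\ell;\ell+n;2)\big]\right)\frac{L^{(1)}_{\ell-1}(x)}{\ell}\Bigg\}.$$ At $x=0$, where $\ln|x|$ and $\mathrm{Ei}(x)$ are singular, the formula holds with the right-hand side read as its limit: the right-hand side tends to $0$ as $x\to0$, and $\partial \mathrm M_{\kappa,1/2}(0)/\partial\kappa=0$ at $\kappa=n$. -/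

import Mathlib

open Filter Topology

noncomputable section

namespace WhittakerDeriv

/-- Kummer's confluent hypergeometric function `₁F₁(a; b; z) = ∑ (a)ₖ / (b)ₖ * zᵏ / k!`,
for `b` not a non-positive integer. The quotient `Γ(a + k) / Γ(a)` is written as the rising
factorial `(a)ₖ`, so that non-positive integers `a` are included. -/
def kummer (a b z : ℂ) : ℂ :=
  ∑' k : ℕ, (ascPochhammer ℂ k).eval a / (ascPochhammer ℂ k).eval b * (z ^ k / (k.factorial : ℂ))

/-- The Whittaker function
`M_{κ,μ}(z) = z ^ (μ + 1/2) * exp (-z/2) * ₁F₁(1/2 + μ - κ; 1 + 2μ; z)`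
(principal power), for `2μ ≠ -1, -2, …`. -/
def whittakerM (κ μ z : ℂ) : ℂ :=
  z ^ (μ + 1 / 2) * Complex.exp (-z / 2) * kummer (1 / 2 + μ - κ) (1 + 2 * μ) z

/-- The exponential integral `Ei(x) = p.v. ∫_{-∞}^x exp t / t dt` of a real number `x ≠ 0`,
as the limit for `ε → 0+` of the integral over `(-∞, x]` with `(-ε, ε)` removed. -/
def Ei (x : ℝ) : ℝ :=
  limUnder (𝓝[>] (0 : ℝ))
    (fun ε : ℝ => ∫ t in Set.Iic x \ Set.Ioo (-ε) ε, Real.exp t / t)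

/-- The generalized Laguerre polynomial
`L_n^{(α)}(x) = ∑_{m=0}^n Γ(n+α+1) / Γ(m+α+1) * (-x)^m / (m! (n-m)!)`,
the quotient of Gamma values being the rising factorial `(m+α+1)_{n-m}`. -/
def laguerre (n : ℕ) (α x : ℝ) : ℝ :=
  ∑ m ∈ Finset.range (n + 1),
    (ascPochhammer ℝ (n - m)).eval ((m : ℝ) + α + 1) *
      ((-x) ^ m / ((m.factorial : ℝ) * ((n - m).factorial : ℝ)))

/-- `F` is an analytic continuation to `ℂ \ [1, ∞)` of the Gauss hypergeometric series
`∑ (a)ₖ (b)ₖ / (c)ₖ * zᵏ / k!`, `|z| < 1`. Since `ℂ \ [1, ∞)` is connected, the values of `F`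
there are determined by this. -/
def IsGaussContinuation (a b c : ℂ) (F : ℂ → ℂ) : Prop :=
  DifferentiableOn ℂ F {z : ℂ | 1 - z ∈ Complex.slitPlane} ∧
    ∀ z : ℂ, ‖z‖ < 1 → F z = ordinaryHypergeometric a b c z

open Classical in
/-- The analytic continuation of the Gauss hypergeometric series to `ℂ \ [1, ∞)`. -/
def gaussContinuation (a b c : ℂ) : ℂ → ℂ :=
  if h : ∃ F : ℂ → ℂ, IsGaussContinuation a b c F then h.choose else 0

open Classical in
/-- The principal branch of the Gauss hypergeometric function `₂F₁(a, b; c; z)`. On the cut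
`[1, ∞)` the value is the limit from the upper half-plane (for real `a`, `b`, `c` the limit from
the lower half-plane is the complex conjugate, with the same real part). -/
def gaussF (a b c z : ℂ) : ℂ :=
  if 1 - z ∈ Complex.slitPlane then gaussContinuation a b c z
  else limUnder (𝓝[>] (0 : ℝ))
    (fun ε : ℝ => gaussContinuation a b c (z + (ε : ℂ) * Complex.I))

end WhittakerDeriv

end

open WhittakerDeriv PowerSeries MeasureTheory

/-! Put m = n - 1. Since M_{κ,1/2}(x) = x e^{-x/2} ₁F₁(1-κ; 2; x), the task is to find G = ∂ₐ ₁F₁(a;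
2; x) at a = -m. Write U_i = ₁F₁(-i; 2; x), W = (eˣ-1)/x, E = ∑_{k≥1} xᵏ/(k·k!), and L for the
operator x y'' + (2-x) y' + m y. Differentiating Kummer's equation in a gives L G = U_m, with G(0) =
0, and a power series killed by L with zero constant term vanishes (`eq_zero_of_kummerOp_eq_zero`).
So the formula is verified by applying L to each of its terms and comparing constant terms
(`kummer_deriv_formal`).

Here L U_i = (m-i) U_i, L W = (m+1) W, and L(E U_m) is explicit. On the products eˣ U_i, L is
bidiagonal. A combination ∑ r_i eˣ U_i is therefore mapped to eˣ ∑ (m+2+i) U_i as soon as r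
satisfies a two-term recursion with r_m = 0. What is left is W times a polynomial identity
(`X_mul_sum_weighted_kummerPoly`).

The numbers r_i = Re ₂F₁(1, i+1; i+m+2; 2) satisfy this recursion by a contiguous relation, and r_m
= 0 by `gaussTwo_self`; their sum (`sum_gaussTwo`) balances the constant terms. Finally Ei(x) = γ +
ln|x| + E(x) (`Ei_eq`) turns E into the bracket of the statement and shows that its singularities at
0 cancel. -/

/-! ### Kummer's equation on formal power series -/

/-- The formal series of `₁F₁(-i; 2; X)`, which is the Laguerre polynomial
`L_i^{(1)}` divided by `i + 1`. -/
noncomputable def kummerPoly (i : ℕ) : ℝ⟦X⟧ :=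
  mk fun j => (-1) ^ j * (i.choose j : ℝ) / ((j + 1).factorial : ℝ)

/-- The operator `y ↦ X y'' + (2 - X) y' + m y` of Kummer's equation with parameters `-m`, `2`. -/
noncomputable def kummerOp (m : ℝ) (y : ℝ⟦X⟧) : ℝ⟦X⟧ :=
  X * d⁄dX ℝ (d⁄dX ℝ y) + (2 - X) * d⁄dX ℝ y + C m * y

/-- The formal series of `(exp x - 1) / x`. -/
noncomputable def expQuot : ℝ⟦X⟧ := mk fun k => 1 / ((k + 1).factorial : ℝ)

/-- The formal series of `∑ x ^ k / (k * k!)`, `k ≥ 1`. -/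
noncomputable def einSeries : ℝ⟦X⟧ := mk fun k => 1 / ((k : ℝ) * (k.factorial : ℝ))

theorem coeff_X_mul_derivative (y : ℝ⟦X⟧) (k : ℕ) :
    coeff k (X * d⁄dX ℝ y) = k * coeff k y := by
  cases k with
  | zero => simp
  | succ k => rw [coeff_succ_X_mul, coeff_derivative]; push_cast; ring

theorem coeff_kummerOp (m : ℝ) (y : ℝ⟦X⟧) (k : ℕ) :
    coeff k (kummerOp m y) = (k + 1) * (k + 2) * coeff (k + 1) y + (m - k) * coeff k y := by
  have h : kummerOp m y = X * d⁄dX ℝ (d⁄dX ℝ y) + C 2 * d⁄dX ℝ y - X * d⁄dX ℝ y + C m * y := by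
    rw [kummerOp, map_ofNat]; ring
  rw [h]
  simp only [map_add, map_sub, coeff_X_mul_derivative, coeff_C_mul, coeff_derivative]
  ring

/-- The indicial exponents at 0 are 0 and -1, so the factor (k+1)(k+2) in the coefficient recursion
never vanishes and the constant term determines the whole solution. -/
theorem eq_zero_of_kummerOp_eq_zero {m : ℝ} {y : ℝ⟦X⟧} (h : kummerOp m y = 0)
    (h0 : coeff 0 y = 0) : y = 0 := by
  ext k
  induction k with
  | zero => simpa using h0
  | succ k ih =>
    have := congrArg (coeff k) h
    rw [coeff_kummerOp, ih] at this
    simp only [map_zero, mul_zero, add_zero, mul_eq_zero] at this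
    have h1 : (k : ℝ) + 1 ≠ 0 := by positivity
    have h2 : (k : ℝ) + 2 ≠ 0 := by positivity
    simpa [h1, h2] using this

theorem kummerOp_add (m : ℝ) (y z : ℝ⟦X⟧) : kummerOp m (y + z) = kummerOp m y + kummerOp m z := by
  simp only [kummerOp, map_add]; ring

theorem kummerOp_C_mul (m c : ℝ) (y : ℝ⟦X⟧) : kummerOp m (C c * y) = C c * kummerOp m y := by
  ext k; simp only [coeff_kummerOp, coeff_C_mul]; ring

theorem kummerOp_sum {ι : Type*} (m : ℝ) (s : Finset ι) (y : ι → ℝ⟦X⟧) :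
    kummerOp m (∑ i ∈ s, y i) = ∑ i ∈ s, kummerOp m (y i) := by
  ext k; simp only [coeff_kummerOp, map_sum, Finset.mul_sum, Finset.sum_add_distrib]

theorem kummerOp_param (m m' : ℝ) (y : ℝ⟦X⟧) : kummerOp m y = kummerOp m' y + C (m - m') * y := by
  simp only [kummerOp, map_sub]; ring

theorem choose_succ_mul (i j : ℕ) :
    (i.choose (j + 1) : ℝ) * (j + 1) = i.choose j * (i - j) := by
  have h := Nat.choose_succ_right_eq i j
  rcases le_or_gt j i with hj | hj
  · have := congrArg (Nat.cast (R := ℝ)) h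
    push_cast [Nat.cast_sub hj] at this
    exact this
  · rw [Nat.choose_eq_zero_of_lt hj, Nat.choose_eq_zero_of_lt (by omega)]; simp

theorem kummerOp_kummerPoly_self (i : ℕ) : kummerOp i (kummerPoly i) = 0 := by
  ext k
  rw [coeff_kummerOp]
  simp only [kummerPoly, coeff_mk, map_zero]
  have h := choose_succ_mul i k
  have hf : ((k + 1 + 1).factorial : ℝ) = (k + 2) * (k + 1).factorial := by
    rw [Nat.factorial_succ (k + 1)]; push_cast; ring
  rw [hf, pow_succ]
  field_simp
  linear_combination (-(-1) ^ k) * h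

theorem kummerOp_kummerPoly (m : ℝ) (i : ℕ) :
    kummerOp m (kummerPoly i) = C (m - i) * kummerPoly i := by
  rw [kummerOp_param m i, kummerOp_kummerPoly_self, zero_add]

theorem X_mul_derivative_kummerPoly_zero : X * d⁄dX ℝ (kummerPoly 0) = 0 := by
  ext k
  rw [coeff_X_mul_derivative]
  cases k <;> simp [kummerPoly]

theorem X_mul_derivative_kummerPoly_succ (i : ℕ) :
    X * d⁄dX ℝ (kummerPoly (i + 1)) = C ((i : ℝ) + 1) * (kummerPoly (i + 1) - kummerPoly i) := by
  ext k
  rw [coeff_X_mul_derivative, coeff_C_mul, map_sub]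
  simp only [kummerPoly, coeff_mk]
  have h : (k : ℝ) * (i + 1).choose k = (i + 1) * ((i + 1).choose k - i.choose k) := by
    cases k with
    | zero => simp
    | succ k =>
      have h1 := congrArg (Nat.cast (R := ℝ)) (Nat.add_one_mul_choose_eq i k)
      have h2 := congrArg (Nat.cast (R := ℝ)) (Nat.choose_succ_succ i k)
      push_cast [Nat.succ_eq_add_one] at h1 h2 ⊢
      linear_combination -h1 + ((i : ℝ) + 1) * (-h2)
  field_simp
  linear_combination h

theorem kummerPoly_succ_sub (m : ℕ) :
    C ((m : ℝ) + 2) * (kummerPoly (m + 1) - kummerPoly m)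
      = X * d⁄dX ℝ (kummerPoly m) - X * kummerPoly m := by
  ext k
  rw [map_sub, coeff_X_mul_derivative, coeff_C_mul, map_sub]
  cases k with
  | zero => simp [kummerPoly]
  | succ k =>
    rw [coeff_succ_X_mul]
    simp only [kummerPoly, coeff_mk]
    have h := choose_succ_mul m k
    have h2 := congrArg (Nat.cast (R := ℝ)) (Nat.choose_succ_succ m k)
    have hf : ((k + 1 + 1).factorial : ℝ) = (k + 2) * (k + 1).factorial := by
      rw [Nat.factorial_succ (k + 1)]; push_cast; ring
    rw [hf, pow_succ]
    push_cast [Nat.succ_eq_add_one] at h2 ⊢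
    rw [h2]
    field_simp
    linear_combination h

theorem X_mul_sum_kummerPoly (m : ℕ) :
    X * ∑ i ∈ Finset.range m, kummerPoly i
      = 1 - kummerPoly m - X * d⁄dX ℝ (kummerPoly m) := by
  induction m with
  | zero =>
    rw [X_mul_derivative_kummerPoly_zero]
    ext k; cases k <;> simp [kummerPoly, coeff_one]
  | succ m ih =>
    rw [Finset.sum_range_succ, mul_add, ih]
    have h1 := kummerPoly_succ_sub m
    have h2 := X_mul_derivative_kummerPoly_succ m
    rw [h2]
    simp only [map_add, map_one, map_ofNat] at h1 ⊢
    linear_combination h1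

/-- This is the identity left over once Kummer's operator has been applied to the claimed formula.
Raising m by one adds a copy of the unweighted sum and one new term, so the induction runs on
`X_mul_sum_kummerPoly` and the contiguous relations of the U_i. -/
theorem X_mul_sum_weighted_kummerPoly (m : ℕ) :
    X * ∑ i ∈ Finset.range m, C ((m : ℝ) + 2 + i) * kummerPoly i
      = C ((m : ℝ) + 1) * (1 - kummerPoly m - 2 * (X * d⁄dX ℝ (kummerPoly m))) := by
  induction m with
  | zero =>
    rw [X_mul_derivative_kummerPoly_zero]
    ext k; cases k <;> simp [kummerPoly, coeff_one]
  | succ m ih =>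
    have h1 := kummerPoly_succ_sub m
    have h2 := X_mul_derivative_kummerPoly_succ m
    have h3 := X_mul_sum_kummerPoly m
    have h4 : ∑ i ∈ Finset.range (m + 1), C (((m + 1 : ℕ) : ℝ) + 2 + i) * kummerPoly i
        = ∑ i ∈ Finset.range m, C ((m : ℝ) + 2 + i) * kummerPoly i
          + ∑ i ∈ Finset.range m, kummerPoly i + C (2 * (m : ℝ) + 3) * kummerPoly m := by
      rw [Finset.sum_range_succ, ← Finset.sum_add_distrib]
      congr 1
      · refine Finset.sum_congr rfl fun i _ => ?_
        push_cast
        simp only [map_add, map_one, map_ofNat]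
        ring
      · congr 2; push_cast; ring
    rw [h4, mul_add, mul_add, ih, h3, h2]
    push_cast
    simp only [map_add, map_mul, map_one, map_ofNat] at h1 ⊢
    linear_combination (2 * C (m : ℝ) + 3) * h1

theorem derivative_einSeries : d⁄dX ℝ einSeries = expQuot := by
  ext k
  rw [coeff_derivative]
  simp only [einSeries, expQuot, coeff_mk]
  push_cast
  field_simp

theorem X_mul_expQuot : X * expQuot = exp ℝ - 1 := by
  ext k
  cases k with
  | zero => simp
  | succ k => rw [coeff_succ_X_mul]; simp [expQuot, coeff_one, coeff_exp]

theorem derivative_exp_real : d⁄dX ℝ (exp ℝ) = exp ℝ := by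
  ext k
  rw [coeff_derivative]
  simp only [coeff_exp, Nat.factorial_succ, eq_ratCast]
  push_cast
  field_simp

theorem X_mul_derivative_expQuot : X * d⁄dX ℝ expQuot = exp ℝ - expQuot := by
  have h := congrArg (d⁄dX ℝ) X_mul_expQuot
  rw [Derivation.leibniz, derivative_X, map_sub, derivative_exp_real, Derivation.map_one_eq_zero]
    at h
  simp only [smul_eq_mul] at h
  linear_combination h

/-- (eˣ-1)/x is ₁F₁(1; 2; x), which solves Kummer's equation with parameter m = -1. -/
theorem kummerOp_expQuot (m : ℝ) : kummerOp m expQuot = C (m + 1) * expQuot := by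
  have h := X_mul_derivative_expQuot
  have h2 := congrArg (d⁄dX ℝ) h
  rw [Derivation.leibniz, derivative_X, map_sub, derivative_exp_real] at h2
  simp only [smul_eq_mul] at h2
  rw [kummerOp]
  simp only [map_add, map_one]
  linear_combination h2 - h

theorem kummerOp_mul (m : ℝ) (f g : ℝ⟦X⟧) :
    kummerOp m (f * g) = f * kummerOp m g + (X * d⁄dX ℝ (d⁄dX ℝ f)) * g
      + 2 * (d⁄dX ℝ f) * (X * d⁄dX ℝ g) + (2 - X) * d⁄dX ℝ f * g := by
  simp only [kummerOp, Derivation.leibniz, map_add, smul_eq_mul]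
  ring

theorem kummerOp_einSeries_mul (m : ℕ) :
    kummerOp m (einSeries * kummerPoly m)
      = kummerPoly m + expQuot * kummerPoly m + 2 * expQuot * (X * d⁄dX ℝ (kummerPoly m)) := by
  have h := X_mul_expQuot
  rw [kummerOp_mul, kummerOp_kummerPoly_self, derivative_einSeries, X_mul_derivative_expQuot]
  linear_combination (-kummerPoly m) * h

theorem kummerOp_exp_mul (m : ℝ) (i : ℕ) :
    kummerOp m (exp ℝ * kummerPoly i)
      = exp ℝ * (C (m + 2 - i) * kummerPoly i + 2 * (X * d⁄dX ℝ (kummerPoly i))) := by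
  rw [kummerOp_mul, kummerOp_kummerPoly, derivative_exp_real, derivative_exp_real]
  simp only [map_add, map_sub, map_ofNat]
  ring

/-- Because x U_i' = i (U_i - U_{i-1}), the operator sends eˣ U_i to eˣ ((m+2+i) U_i - 2i U_{i-1}).
The recursion for r makes every coefficient collapse to m+2+i, apart from a boundary term in r
(M+1). -/
theorem kummerOp_exp_mul_sum {m : ℝ} {r : ℕ → ℝ}
    (hr : ∀ i : ℕ, 2 * ((i : ℝ) + 1) * r (i + 1) = (m + 2 + i) * (r i - 1)) (M : ℕ) :
    kummerOp m (exp ℝ * ∑ i ∈ Finset.range (M + 1), C (r i) * kummerPoly i)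
      = exp ℝ * (∑ i ∈ Finset.range (M + 1), C (m + 2 + i) * kummerPoly i
          + C (2 * ((M : ℝ) + 1) * r (M + 1)) * kummerPoly M) := by
  have e : ∀ i, exp ℝ * (C (r i) * kummerPoly i) = C (r i) * (exp ℝ * kummerPoly i) :=
    fun i => by ring
  induction M with
  | zero =>
    have h0 := X_mul_derivative_kummerPoly_zero
    simp only [zero_add, Finset.sum_range_one]
    rw [e, kummerOp_C_mul, kummerOp_exp_mul, h0]
    have := hr 0
    push_cast at this ⊢
    rw [zero_add] at this
    rw [zero_add, this]
    simp only [map_add, map_sub, map_mul, map_ofNat, map_one, map_zero]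
    ring
  | succ M ih =>
    rw [Finset.sum_range_succ, mul_add, kummerOp_add, ih, e, kummerOp_C_mul, kummerOp_exp_mul,
      X_mul_derivative_kummerPoly_succ, Finset.sum_range_succ _ (M + 1)]
    have := congrArg (C (R := ℝ)) (hr (M + 1))
    push_cast at this ⊢
    simp only [map_add, map_sub, map_mul, map_ofNat, map_one] at this ⊢
    linear_combination (-(exp ℝ * kummerPoly (M + 1))) * this

/-- The `a`-derivative of `₁F₁(a; 2; x)` at `a = -m`, as a formal series identity: `G` is
characterised by `kummerOp m G = ₁F₁(-m; 2; X)` and `G(0) = 0`. -/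
theorem kummer_deriv_formal {m : ℕ} {r : ℕ → ℝ} {H : ℝ} {G : ℝ⟦X⟧}
    (hG : kummerOp m G = kummerPoly m) (hG0 : coeff 0 G = 0)
    (hr : ∀ i : ℕ, 2 * ((i : ℝ) + 1) * r (i + 1) = ((m : ℝ) + 2 + i) * (r i - 1))
    (hrm : r m = 0)
    (h0 : 1 - H * ((m : ℝ) + 1)
      + ∑ i ∈ Finset.range m, ((m : ℝ) + 2 + i) / ((m : ℝ) - i) - ∑ i ∈ Finset.range m, r i = 0) :
    C ((m : ℝ) + 1) * G + expQuot - C ((m : ℝ) + 1) * ((C H + einSeries) * kummerPoly m)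
      + ∑ i ∈ Finset.range m, C (((m : ℝ) + 2 + i) / ((m : ℝ) - i)) * kummerPoly i
      - exp ℝ * ∑ i ∈ Finset.range m, C (r i) * kummerPoly i = 0 := by
  have hS : kummerOp m (exp ℝ * ∑ i ∈ Finset.range m, C (r i) * kummerPoly i)
      = exp ℝ * ∑ i ∈ Finset.range m, C ((m : ℝ) + 2 + i) * kummerPoly i := by
    cases m with
    | zero => simp [kummerOp]
    | succ M => rw [kummerOp_exp_mul_sum hr M, hrm]; simp
  have hQ : kummerOp m
      (∑ i ∈ Finset.range m, C (((m : ℝ) + 2 + i) / ((m : ℝ) - i)) * kummerPoly i)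
      = ∑ i ∈ Finset.range m, C ((m : ℝ) + 2 + i) * kummerPoly i := by
    rw [kummerOp_sum]
    refine Finset.sum_congr rfl fun i hi => ?_
    have : (m : ℝ) - i ≠ 0 := by
      have := Finset.mem_range.1 hi
      rw [sub_ne_zero]; exact_mod_cast this.ne'
    rw [kummerOp_C_mul, kummerOp_kummerPoly, ← mul_assoc, ← map_mul, div_mul_cancel₀ _ this]
  have hX := X_mul_sum_weighted_kummerPoly m
  have hA := X_mul_expQuot
  refine eq_zero_of_kummerOp_eq_zero (m := m) ?_ ?_
  -- The U_m terms cancel. With S = ∑ (m+2+i) U_i, there remains (m+1) W (1 - U_m - 2x U_m') - (eˣ -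
  -- 1) S, which is zero by `hX` after writing eˣ - 1 = x W.
  · have e : ∀ a b c d f : ℝ⟦X⟧, kummerOp m (a + b - C ((m : ℝ) + 1) * ((C H + c) * kummerPoly m)
        + d - f)
        = kummerOp m a + kummerOp m b - C ((m : ℝ) + 1) * (C H * kummerOp m (kummerPoly m)
          + kummerOp m (c * kummerPoly m)) + kummerOp m d - kummerOp m f := by
      intro a b c d f
      have : a + b - C ((m : ℝ) + 1) * ((C H + c) * kummerPoly m) + d - f
        = a + b + C (-((m : ℝ) + 1)) * (C H * kummerPoly m + c * kummerPoly m) + d + C (-1) * f := by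
        simp only [map_neg, map_one]; ring
      simp only [this, kummerOp_add, kummerOp_C_mul]
      simp only [map_neg, map_one]; ring
    rw [e, kummerOp_C_mul, hG, kummerOp_expQuot, kummerOp_kummerPoly_self, kummerOp_einSeries_mul,
      hS, hQ]
    linear_combination (-expQuot) * hX
      + (∑ i ∈ Finset.range m, C ((m : ℝ) + 2 + i) * kummerPoly i) * hA
  · simp only [coeff_zero_eq_constantCoeff] at hG0 ⊢
    have hU : ∀ i, constantCoeff (kummerPoly i) = 1 := fun i => by
      rw [← coeff_zero_eq_constantCoeff_apply]; simp [kummerPoly]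
    have hE : constantCoeff einSeries = 0 := by
      rw [← coeff_zero_eq_constantCoeff_apply]; simp [einSeries]
    have hW : constantCoeff expQuot = 1 := by
      rw [← coeff_zero_eq_constantCoeff_apply]; simp [expQuot]
    simp only [map_add, map_sub, map_mul, map_sum, hG0, hU, hE, hW, constantCoeff_C,
      constantCoeff_exp]
    simp only [mul_one]
    linear_combination h0

/-! ### Contiguous relations for ₂F₁(1, l; l+n; z) in the unit disc -/

theorem ascPochhammer_eval_succ_mul {R : Type*} [CommRing R] (x : R) (k : ℕ) :
    x * (ascPochhammer R k).eval (x + 1) = (ascPochhammer R k).eval x * (x + k) := by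
  rw [← ascPochhammer_succ_eval, ascPochhammer_succ_left]
  simp

theorem ascPochhammer_eval_natCast_ne_zero {l : ℕ} (hl : 1 ≤ l) (k : ℕ) :
    (ascPochhammer ℂ k).eval (l : ℂ) ≠ 0 := by
  rw [Ne, ascPochhammer_eval_eq_zero_iff]
  rintro ⟨j, -, hj⟩
  have : ((j + l : ℕ) : ℂ) = 0 := by push_cast; rw [hj]; ring
  rw [Nat.cast_eq_zero] at this
  omega

/-- The coefficients of `₂F₁(1, l; l + n; z)`. -/
noncomputable def gaussCoeff (l n k : ℕ) : ℂ :=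
  (ascPochhammer ℂ k).eval (l : ℂ) / (ascPochhammer ℂ k).eval ((l : ℂ) + n)

theorem gaussCoeff_zero (l n : ℕ) : gaussCoeff l n 0 = 1 := by simp [gaussCoeff]

theorem ordinaryHypergeometric_one_eq_tsum (l n : ℕ) (z : ℂ) :
    ordinaryHypergeometric 1 (l : ℂ) ((l : ℂ) + n) z = ∑' k, gaussCoeff l n k * z ^ k := by
  rw [ordinaryHypergeometric_eq_tsum]
  refine tsum_congr fun k => ?_
  rw [ascPochhammer_eval_one, inv_mul_cancel₀ (by exact_mod_cast k.factorial_ne_zero), one_mul,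
    smul_eq_mul, gaussCoeff, div_eq_mul_inv]

theorem gaussCoeff_succ (l n k : ℕ) :
    gaussCoeff l n (k + 1) = l / ((l : ℂ) + n) * gaussCoeff (l + 1) n k := by
  have h1 : (ascPochhammer ℂ (k + 1)).eval (l : ℂ)
      = l * (ascPochhammer ℂ k).eval ((l : ℂ) + 1) := by
    rw [ascPochhammer_succ_eval, ascPochhammer_eval_succ_mul]
  have h2 : (ascPochhammer ℂ (k + 1)).eval ((l : ℂ) + n)
      = (l + n) * (ascPochhammer ℂ k).eval ((l : ℂ) + n + 1) := by
    rw [ascPochhammer_succ_eval, ascPochhammer_eval_succ_mul]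
  rw [gaussCoeff, gaussCoeff, h1, h2]
  push_cast
  rw [show (l : ℂ) + 1 + n = l + n + 1 by ring, mul_div_mul_comm]

theorem gaussCoeff_succ_right {l n : ℕ} (hl : 1 ≤ l) (k : ℕ) :
    n / ((l : ℂ) + n) * gaussCoeff l (n + 1) k
      = gaussCoeff l n k - l / ((l : ℂ) + n) * gaussCoeff (l + 1) n k := by
  have h1 := ascPochhammer_eval_succ_mul (l : ℂ) k
  have h2 := ascPochhammer_eval_succ_mul ((l : ℂ) + n) k
  have h3 : (ascPochhammer ℂ k).eval ((l : ℂ) + n) ≠ 0 := by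
    have := ascPochhammer_eval_natCast_ne_zero (show 1 ≤ l + n by omega) k
    push_cast at this; exact this
  have h4 : (ascPochhammer ℂ k).eval ((l : ℂ) + n + 1) ≠ 0 := by
    have := ascPochhammer_eval_natCast_ne_zero (show 1 ≤ l + n + 1 by omega) k
    push_cast at this; exact this
  have h5 : (l : ℂ) + n ≠ 0 := by exact_mod_cast (show l + n ≠ 0 by omega)
  simp only [gaussCoeff]
  push_cast
  rw [show (l : ℂ) + 1 + n = l + n + 1 by ring, ← add_assoc (l : ℂ) n 1]
  field_simp
  linear_combination (-(ascPochhammer ℂ k).eval ((l : ℂ))) * h2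
    + (ascPochhammer ℂ k).eval ((l : ℂ) + n) * h1

theorem norm_gaussCoeff_le (l n k : ℕ) : ‖gaussCoeff l n k‖ ≤ 1 := by
  induction k generalizing l with
  | zero => simp [gaussCoeff]
  | succ k ih =>
    rw [gaussCoeff_succ, norm_mul]
    refine mul_le_one₀ ?_ (norm_nonneg _) (ih _)
    rw [norm_div, ← Nat.cast_add, Complex.norm_natCast, Complex.norm_natCast]
    exact div_le_one_of_le₀ (by push_cast; linarith [(Nat.cast_nonneg n : (0:ℝ) ≤ n)])
      (Nat.cast_nonneg _)

theorem hasSum_gaussCoeff (l n : ℕ) {z : ℂ} (hz : ‖z‖ < 1) :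
    HasSum (fun k => gaussCoeff l n k * z ^ k)
      (ordinaryHypergeometric 1 (l : ℂ) ((l : ℂ) + n) z) := by
  rw [ordinaryHypergeometric_one_eq_tsum]
  refine (Summable.of_norm_bounded (summable_geometric_of_lt_one (norm_nonneg z) hz)
    fun k => ?_).hasSum
  rw [norm_mul, norm_pow]
  exact mul_le_of_le_one_left (by positivity) (norm_gaussCoeff_le l n k)

theorem ordinaryHypergeometric_one_eq_add (l n : ℕ) {z : ℂ} (hz : ‖z‖ < 1) :
    ordinaryHypergeometric 1 (l : ℂ) ((l : ℂ) + n) z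
      = 1 + l / ((l : ℂ) + n) * z
        * ordinaryHypergeometric 1 ((l + 1 : ℕ) : ℂ) (((l + 1 : ℕ) : ℂ) + n) z := by
  have h := (hasSum_gaussCoeff (l + 1) n hz).mul_left
    (l / ((l : ℂ) + n) * z)
  have h' : HasSum (fun k => gaussCoeff l n (k + 1) * z ^ (k + 1)) (l / ((l : ℂ) + n) * z
        * ordinaryHypergeometric 1 ((l + 1 : ℕ) : ℂ) (((l + 1 : ℕ) : ℂ) + n) z) := by
    refine h.congr_fun fun k => ?_
    rw [gaussCoeff_succ]; ring
  refine (hasSum_gaussCoeff l n hz).unique ((hasSum_nat_add_iff' 1).1 ?_)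
  simpa [gaussCoeff_zero] using h'

theorem ordinaryHypergeometric_one_contiguous {l : ℕ} (hl : 1 ≤ l) (n : ℕ) {z : ℂ} (hz : ‖z‖ < 1) :
    n / ((l : ℂ) + n) * ordinaryHypergeometric 1 (l : ℂ) ((l : ℂ) + (n + 1 : ℕ)) z
      = ordinaryHypergeometric 1 (l : ℂ) ((l : ℂ) + n) z - l / ((l : ℂ) + n)
        * ordinaryHypergeometric 1 ((l + 1 : ℕ) : ℂ) (((l + 1 : ℕ) : ℂ) + n) z := by
  have h1 := (hasSum_gaussCoeff l (n + 1) hz).mul_left (n / ((l : ℂ) + n))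
  have h2 := (hasSum_gaussCoeff l n hz).sub
    ((hasSum_gaussCoeff (l + 1) n hz).mul_left (l / ((l : ℂ) + n)))
  refine h1.unique (h2.congr_fun fun k => ?_)
  rw [← mul_assoc, gaussCoeff_succ_right hl]; ring

theorem ordinaryHypergeometric_one_one_two {z : ℂ} (hz : ‖z‖ < 1) :
    z * ordinaryHypergeometric 1 ((1 : ℕ) : ℂ) (((1 : ℕ) : ℂ) + (1 : ℕ)) z
      = -Complex.log (1 - z) := by
  have h1 := (hasSum_gaussCoeff 1 1 hz).mul_left z
  have h2 := (hasSum_nat_add_iff' 1).2 (Complex.hasSum_taylorSeries_neg_log hz)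
  simp only [Finset.sum_range_one, pow_zero, Nat.cast_zero, div_zero, sub_zero] at h2
  refine h1.unique (h2.congr_fun fun k => ?_)
  have : gaussCoeff 1 1 k = 1 / ((k : ℂ) + 1) := by
    have h := ascPochhammer_eval_succ_mul (1 : ℂ) k
    have h0 : (ascPochhammer ℂ k).eval (1 : ℂ) ≠ 0 := by
      simpa using ascPochhammer_eval_natCast_ne_zero le_rfl k
    rw [one_mul] at h
    rw [gaussCoeff]
    push_cast
    rw [h, add_comm (1 : ℂ), div_mul_eq_div_div, div_self h0]
  rw [this]
  push_cast
  ring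

theorem ordinaryHypergeometric_one_continuousAt_zero {l : ℕ} (hl : 1 ≤ l) (n : ℕ) :
    ContinuousAt (ordinaryHypergeometric 1 (l : ℂ) ((l : ℂ) + n) : ℂ → ℂ) 0 := by
  have hr : (ordinaryHypergeometricSeries ℂ 1 (l : ℂ) ((l : ℂ) + n)).radius = 1 := by
    refine ordinaryHypergeometricSeries_radius_eq_one _ _ _ _ fun k => ⟨?_, ?_, ?_⟩
    all_goals
      rw [Ne, eq_neg_iff_add_eq_zero]
      norm_cast <;> omega
  have h := (ordinaryHypergeometricSeries ℂ 1 (l : ℂ) ((l : ℂ) + n)).hasFPowerSeriesOnBall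
    (by rw [hr]; exact one_pos)
  exact h.analyticAt.continuousAt

/-! ### Analytic continuation to the cut plane -/

/-- `ℂ \ [1, ∞)`. -/
def cutPlane : Set ℂ := {z : ℂ | 1 - z ∈ Complex.slitPlane}

theorem isOpen_cutPlane : IsOpen cutPlane :=
  Complex.isOpen_slitPlane.preimage (by fun_prop)

theorem isPreconnected_cutPlane : IsPreconnected cutPlane := by
  have : cutPlane = (fun z : ℂ => 1 - z) '' Complex.slitPlane := by
    ext z; constructor
    · exact fun h => ⟨1 - z, h, by ring⟩
    · rintro ⟨w, hw, rfl⟩; simpa [cutPlane] using hw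
  rw [this]
  exact (Complex.starConvex_one_slitPlane.isPathConnected
    Complex.one_mem_slitPlane).isConnected.isPreconnected.image _ (by fun_prop)

theorem mem_cutPlane_of_norm_lt_one {z : ℂ} (hz : ‖z‖ < 1) : z ∈ cutPlane := by
  refine Or.inl ?_
  have := (Complex.abs_re_le_norm z).trans_lt hz
  simp only [Complex.sub_re, Complex.one_re]
  linarith [(abs_lt.1 this).2]

/-- The identity theorem; it carries each relation between the series over to the chosen
continuations. -/
theorem eqOn_cutPlane {f g : ℂ → ℂ} (hf : DifferentiableOn ℂ f cutPlane)
    (hg : DifferentiableOn ℂ g cutPlane) (h : ∀ z, ‖z‖ < 1 → f z = g z) :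
    Set.EqOn f g cutPlane := by
  refine (hf.analyticOnNhd isOpen_cutPlane).eqOn_of_preconnected_of_eventuallyEq
    (hg.analyticOnNhd isOpen_cutPlane) isPreconnected_cutPlane
    (mem_cutPlane_of_norm_lt_one (z := 0) (by simp)) ?_
  filter_upwards [Metric.ball_mem_nhds (0 : ℂ) one_pos] with z hz
  exact h z (by simpa using hz)

theorem isGaussContinuation_of_ne_zero {l n : ℕ} (hl : 1 ≤ l) {F : ℂ → ℂ}
    (hF : DifferentiableOn ℂ F cutPlane)
    (h : ∀ z, z ≠ 0 → ‖z‖ < 1 → F z = ordinaryHypergeometric 1 (l : ℂ) ((l : ℂ) + n) z) :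
    IsGaussContinuation 1 l ((l : ℂ) + n) F := by
  refine ⟨hF, fun z hz => ?_⟩
  rcases eq_or_ne z 0 with rfl | hz0
  · have h1 : Tendsto F (𝓝[≠] 0) (𝓝 (F 0)) :=
      (hF.differentiableAt (isOpen_cutPlane.mem_nhds
        (mem_cutPlane_of_norm_lt_one hz))).continuousAt.tendsto.mono_left nhdsWithin_le_nhds
    have h2 := (ordinaryHypergeometric_one_continuousAt_zero hl n).tendsto.mono_left
      (nhdsWithin_le_nhds (s := {0}ᶜ))
    refine tendsto_nhds_unique_of_eventuallyEq h1 h2 ?_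
    filter_upwards [self_mem_nhdsWithin,
      mem_nhdsWithin_of_mem_nhds (Metric.ball_mem_nhds (0 : ℂ) one_pos)] with w hw hw1
    exact h w hw (by simpa using hw1)
  · exact h z hz0 hz

/-- The relation F_l = 1 + l/(l+n) z F_{l+1} is solved for F_{l+1}; dividing F_l - F_l(0) by z
leaves a removable singularity at 0, which `dslope` fills in. -/
theorem exists_isGaussContinuation_succ_left {l n : ℕ} (hl : 1 ≤ l)
    (h : ∃ F, IsGaussContinuation 1 l ((l : ℂ) + n) F) :
    ∃ F, IsGaussContinuation 1 ((l + 1 : ℕ) : ℂ) (((l + 1 : ℕ) : ℂ) + n) F := by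
  obtain ⟨F, hF, hF1⟩ := h
  have hmem : cutPlane ∈ 𝓝 (0 : ℂ) :=
    isOpen_cutPlane.mem_nhds (mem_cutPlane_of_norm_lt_one (by simp))
  refine ⟨fun z => ((l : ℂ) + n) / l * dslope F 0 z, isGaussContinuation_of_ne_zero (by omega)
    (((Complex.differentiableOn_dslope hmem).2 hF).const_mul _) fun z hz0 hz => ?_⟩
  rw [dslope_of_ne _ hz0, slope_def_field, hF1 z hz, hF1 0 (by simp),
    ordinaryHypergeometric_one_eq_add l n hz, ordinaryHypergeometric_zero]
  have h5 : (l : ℂ) + n ≠ 0 := by exact_mod_cast (show l + n ≠ 0 by omega)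
  have h6 : (l : ℂ) ≠ 0 := by exact_mod_cast (show l ≠ 0 by omega)
  field_simp
  ring

theorem exists_isGaussContinuation_succ_right {l n : ℕ} (hl : 1 ≤ l) (hn : 1 ≤ n)
    (h : ∃ F, IsGaussContinuation 1 l ((l : ℂ) + n) F) :
    ∃ F, IsGaussContinuation 1 l ((l : ℂ) + (n + 1 : ℕ)) F := by
  obtain ⟨G, hG, hG1⟩ := exists_isGaussContinuation_succ_left hl h
  obtain ⟨F, hF, hF1⟩ := h
  refine ⟨fun z => ((l : ℂ) + n) / n * (F z - l / ((l : ℂ) + n) * G z),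
    (hF.sub (hG.const_mul _)).const_mul _, fun z hz => ?_⟩
  have h := ordinaryHypergeometric_one_contiguous hl n hz
  simp only [hF1 z hz, hG1 z hz, ← h]
  have h5 : (l : ℂ) + n ≠ 0 := by exact_mod_cast (show l + n ≠ 0 by omega)
  have h6 : (n : ℂ) ≠ 0 := by exact_mod_cast (show n ≠ 0 by omega)
  field_simp

theorem differentiableOn_log_one_sub :
    DifferentiableOn ℂ (fun z => -Complex.log (1 - z)) cutPlane := by
  refine DifferentiableOn.neg (DifferentiableOn.clog (by fun_prop) fun z hz => hz)

theorem exists_isGaussContinuation {l n : ℕ} (hl : 1 ≤ l) (hn : 1 ≤ n) :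
    ∃ F, IsGaussContinuation 1 l ((l : ℂ) + n) F := by
  induction l, hl using Nat.le_induction with
  | base =>
    induction n, hn using Nat.le_induction with
    | base =>
      have hmem : cutPlane ∈ 𝓝 (0 : ℂ) :=
        isOpen_cutPlane.mem_nhds (mem_cutPlane_of_norm_lt_one (by simp))
      refine ⟨_, isGaussContinuation_of_ne_zero le_rfl
        ((Complex.differentiableOn_dslope hmem).2 differentiableOn_log_one_sub) fun z hz0 hz => ?_⟩
      rw [dslope_of_ne _ hz0, slope_def_field, ← ordinaryHypergeometric_one_one_two hz]
      simp only [sub_zero, Complex.log_one, neg_zero]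
      rw [mul_div_cancel_left₀ _ hz0]
    | succ n hn ih => exact exists_isGaussContinuation_succ_right le_rfl hn ih
  | succ l hl ih => exact exists_isGaussContinuation_succ_left hl ih

theorem isGaussContinuation_gaussContinuation {l n : ℕ} (hl : 1 ≤ l) (hn : 1 ≤ n) :
    IsGaussContinuation 1 l ((l : ℂ) + n) (gaussContinuation 1 l ((l : ℂ) + n)) := by
  have h := exists_isGaussContinuation hl hn
  rw [gaussContinuation, dif_pos h]
  exact h.choose_spec

theorem gaussContinuation_eq_add {l n : ℕ} (hl : 1 ≤ l) (hn : 1 ≤ n) {z : ℂ}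
    (hz : z ∈ cutPlane) :
    gaussContinuation 1 l ((l : ℂ) + n) z = 1 + l / ((l : ℂ) + n) * z
      * gaussContinuation 1 ((l + 1 : ℕ) : ℂ) (((l + 1 : ℕ) : ℂ) + n) z := by
  have hF := isGaussContinuation_gaussContinuation hl hn
  have hG := isGaussContinuation_gaussContinuation (show 1 ≤ l + 1 by omega) hn
  refine eqOn_cutPlane hF.1 (g := fun z => 1 + l / ((l : ℂ) + n) * z
      * gaussContinuation 1 ((l + 1 : ℕ) : ℂ) (((l + 1 : ℕ) : ℂ) + n) z)
    (((differentiableOn_id.const_mul _).mul hG.1).const_add _) (fun w hw => ?_) hz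
  rw [hF.2 w hw, hG.2 w hw, ordinaryHypergeometric_one_eq_add l n hw]

theorem gaussContinuation_contiguous {l n : ℕ} (hl : 1 ≤ l) (hn : 1 ≤ n) {z : ℂ}
    (hz : z ∈ cutPlane) :
    n / ((l : ℂ) + n) * gaussContinuation 1 l ((l : ℂ) + (n + 1 : ℕ)) z
      = gaussContinuation 1 l ((l : ℂ) + n) z - l / ((l : ℂ) + n)
        * gaussContinuation 1 ((l + 1 : ℕ) : ℂ) (((l + 1 : ℕ) : ℂ) + n) z := by
  have hF := isGaussContinuation_gaussContinuation hl hn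
  have hG := isGaussContinuation_gaussContinuation (show 1 ≤ l + 1 by omega) hn
  have hK := isGaussContinuation_gaussContinuation hl (show 1 ≤ n + 1 by omega)
  refine eqOn_cutPlane
    (f := fun z => n / ((l : ℂ) + n) * gaussContinuation 1 l ((l : ℂ) + (n + 1 : ℕ)) z)
    (g := fun z => gaussContinuation 1 l ((l : ℂ) + n) z - l / ((l : ℂ) + n)
      * gaussContinuation 1 ((l + 1 : ℕ) : ℂ) (((l + 1 : ℕ) : ℂ) + n) z)
    (hK.1.const_mul _) (hF.1.sub (hG.1.const_mul _)) (fun w hw => ?_) hz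
  simp only [hF.2 w hw, hG.2 w hw, hK.2 w hw, ordinaryHypergeometric_one_contiguous hl n hw]

theorem gaussContinuation_one_one_two {z : ℂ} (hz : z ∈ cutPlane) :
    z * gaussContinuation 1 ((1 : ℕ) : ℂ) (((1 : ℕ) : ℂ) + (1 : ℕ)) z = -Complex.log (1 - z) := by
  have hF := isGaussContinuation_gaussContinuation le_rfl le_rfl
  refine eqOn_cutPlane
    (f := fun z => z * gaussContinuation 1 ((1 : ℕ) : ℂ) (((1 : ℕ) : ℂ) + (1 : ℕ)) z)
    (differentiableOn_id.mul hF.1) differentiableOn_log_one_sub (fun w hw => ?_) hz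
  simp only [hF.2 w hw, ordinaryHypergeometric_one_one_two hw]

/-! ### Boundary values at z = 2 and their sums -/

theorem two_add_mul_I_mem_cutPlane {ε : ℝ} (hε : 0 < ε) : (2 : ℂ) + ε * Complex.I ∈ cutPlane := by
  refine Or.inr ?_
  simp [hε.ne']

theorem tendsto_two_add_mul_I :
    Tendsto (fun ε : ℝ => (2 : ℂ) + ε * Complex.I) (𝓝[>] 0) (𝓝 2) := by
  have : Continuous fun ε : ℝ => (2 : ℂ) + ε * Complex.I := by fun_prop
  simpa using (this.tendsto 0).mono_left (nhdsWithin_le_nhds (s := Set.Ioi 0))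

theorem tendsto_gaussContinuation_one_one_two :
    Tendsto (fun ε : ℝ => gaussContinuation 1 ((1 : ℕ) : ℂ) (((1 : ℕ) : ℂ) + (1 : ℕ))
      (2 + ε * Complex.I)) (𝓝[>] 0) (𝓝 (Real.pi * Complex.I / 2)) := by
  -- As z tends to 2 from above, 1 - z tends to -1 from below, so log(1-z) tends to -πi. The limit
  -- πi/2 has real part 0.
  have h1 := Complex.tendsto_log_nhdsWithin_im_neg_of_re_neg_of_im_zero (z := -1) (by simp)
    (by simp)
  have h2 : Tendsto (fun ε : ℝ => (1 : ℂ) - (2 + ε * Complex.I)) (𝓝[>] 0)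
      (𝓝[{z : ℂ | z.im < 0}] (-1)) := by
    refine tendsto_nhdsWithin_iff.2 ⟨?_, ?_⟩
    · have := tendsto_two_add_mul_I.const_sub 1
      norm_num at this
      exact this
    · filter_upwards [self_mem_nhdsWithin] with ε hε
      simpa using hε
  have h3 := ((h1.comp h2).neg).div tendsto_two_add_mul_I two_ne_zero
  have h4 : Real.pi * Complex.I / 2
      = -(((Real.log ‖(-1 : ℂ)‖ : ℝ) : ℂ) - Real.pi * Complex.I) / 2 := by simp
  rw [h4]
  refine h3.congr' ?_
  filter_upwards [self_mem_nhdsWithin] with ε hε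
  have hm := two_add_mul_I_mem_cutPlane hε
  have h0 : (2 : ℂ) + ε * Complex.I ≠ 0 := fun h => by
    have := congrArg Complex.re h
    simp at this
  simp only [Function.comp_apply, Pi.div_apply]
  rw [← gaussContinuation_one_one_two hm]
  exact mul_div_cancel_left₀ _ h0

theorem gaussF_two_of_tendsto {a b c L : ℂ}
    (h : Tendsto (fun ε : ℝ => gaussContinuation a b c (2 + ε * Complex.I)) (𝓝[>] 0) (𝓝 L)) :
    gaussF a b c 2 = L := by
  rw [gaussF, if_neg, h.limUnder_eq]
  norm_num [Complex.mem_slitPlane_iff]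

theorem tendsto_gaussContinuation_succ_left {l n : ℕ} {L : ℂ} (hl : 1 ≤ l) (hn : 1 ≤ n)
    (h : Tendsto (fun ε : ℝ => gaussContinuation 1 l ((l : ℂ) + n) (2 + ε * Complex.I))
      (𝓝[>] 0) (𝓝 L)) :
    Tendsto (fun ε : ℝ => gaussContinuation 1 ((l + 1 : ℕ) : ℂ) (((l + 1 : ℕ) : ℂ) + n)
      (2 + ε * Complex.I)) (𝓝[>] 0) (𝓝 ((L - 1) * ((l + n) / (2 * l)))) := by
  have h5 : (l : ℂ) + n ≠ 0 := by exact_mod_cast (show l + n ≠ 0 by omega)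
  have h6 : (l : ℂ) ≠ 0 := by exact_mod_cast (show l ≠ 0 by omega)
  have h1 := (h.sub_const 1).mul ((tendsto_const_nhds (x := (l : ℂ) + n)).div
    (tendsto_two_add_mul_I.mul_const (l : ℂ)) (mul_ne_zero two_ne_zero h6))
  refine h1.congr' ?_
  filter_upwards [self_mem_nhdsWithin] with ε hε
  have h0 : (2 : ℂ) + ε * Complex.I ≠ 0 := fun h => by
    have := congrArg Complex.re h
    simp at this
  rw [gaussContinuation_eq_add hl hn (two_add_mul_I_mem_cutPlane hε)]
  simp only [Pi.div_apply]
  field_simp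
  ring

/-- The limit for (l+1, n) from `tendsto_gaussContinuation_succ_left` is inserted into the
contiguous relation and eliminated. -/
theorem tendsto_gaussContinuation_succ_right {l n : ℕ} {L : ℂ} (hl : 1 ≤ l) (hn : 1 ≤ n)
    (h : Tendsto (fun ε : ℝ => gaussContinuation 1 l ((l : ℂ) + n) (2 + ε * Complex.I))
      (𝓝[>] 0) (𝓝 L)) :
    Tendsto (fun ε : ℝ => gaussContinuation 1 l ((l : ℂ) + (n + 1 : ℕ))
      (2 + ε * Complex.I)) (𝓝[>] 0) (𝓝 ((L + 1) * ((l + n) / (2 * n)))) := by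
  have h5 : (l : ℂ) + n ≠ 0 := by exact_mod_cast (show l + n ≠ 0 by omega)
  have h6 : (l : ℂ) ≠ 0 := by exact_mod_cast (show l ≠ 0 by omega)
  have h7 : (n : ℂ) ≠ 0 := by exact_mod_cast (show n ≠ 0 by omega)
  have h1 := (h.sub ((tendsto_gaussContinuation_succ_left hl hn h).const_mul
    (l / ((l : ℂ) + n)))).const_mul (((l : ℂ) + n) / n)
  have e : (L + 1) * (((l : ℂ) + n) / (2 * n))
      = ((l : ℂ) + n) / n * (L - l / ((l : ℂ) + n) * ((L - 1) * ((l + n) / (2 * l)))) := by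
    field_simp; ring
  rw [e]
  refine h1.congr' ?_
  filter_upwards [self_mem_nhdsWithin] with ε hε
  rw [← gaussContinuation_contiguous hl hn (two_add_mul_I_mem_cutPlane hε)]
  field_simp

theorem exists_tendsto_gaussContinuation {l n : ℕ} (hl : 1 ≤ l) (hn : 1 ≤ n) :
    ∃ L, Tendsto (fun ε : ℝ => gaussContinuation 1 l ((l : ℂ) + n) (2 + ε * Complex.I))
      (𝓝[>] 0) (𝓝 L) := by
  induction l, hl using Nat.le_induction with
  | base =>
    induction n, hn using Nat.le_induction with
    | base => exact ⟨_, tendsto_gaussContinuation_one_one_two⟩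
    | succ n hn ih =>
      obtain ⟨L, hL⟩ := ih
      exact ⟨_, tendsto_gaussContinuation_succ_right le_rfl hn hL⟩
  | succ l hl ih =>
    obtain ⟨L, hL⟩ := ih
    exact ⟨_, tendsto_gaussContinuation_succ_left hl hn hL⟩

/-- The real part of `₂F₁(1, l; l + n; 2)`. -/
noncomputable def gaussTwo (l n : ℕ) : ℝ := (gaussF 1 l ((l : ℂ) + n) 2).re

theorem gaussTwo_one_one : gaussTwo 1 1 = 0 := by
  rw [gaussTwo, gaussF_two_of_tendsto tendsto_gaussContinuation_one_one_two]
  simp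

theorem gaussTwo_succ_left {l n : ℕ} (hl : 1 ≤ l) (hn : 1 ≤ n) :
    2 * l * gaussTwo (l + 1) n = (l + n) * (gaussTwo l n - 1) := by
  obtain ⟨L, hL⟩ := exists_tendsto_gaussContinuation hl hn
  rw [gaussTwo, gaussTwo, gaussF_two_of_tendsto hL,
    gaussF_two_of_tendsto (tendsto_gaussContinuation_succ_left hl hn hL)]
  have e : ((l : ℂ) + n) / (2 * l) = ((((l : ℝ) + n) / (2 * l) : ℝ) : ℂ) := by push_cast; rfl
  rw [e, Complex.re_mul_ofReal, Complex.sub_re, Complex.one_re]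
  have h6 : (l : ℝ) ≠ 0 := by exact_mod_cast (show l ≠ 0 by omega)
  field_simp

theorem gaussTwo_succ_right {l n : ℕ} (hl : 1 ≤ l) (hn : 1 ≤ n) :
    2 * n * gaussTwo l (n + 1) = (l + n) * (gaussTwo l n + 1) := by
  obtain ⟨L, hL⟩ := exists_tendsto_gaussContinuation hl hn
  rw [gaussTwo, gaussTwo, gaussF_two_of_tendsto hL,
    gaussF_two_of_tendsto (tendsto_gaussContinuation_succ_right hl hn hL)]
  have e : ((l : ℂ) + n) / (2 * n) = ((((l : ℝ) + n) / (2 * n) : ℝ) : ℂ) := by push_cast; rfl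
  rw [e, Complex.re_mul_ofReal, Complex.add_re, Complex.one_re]
  have h6 : (n : ℝ) ≠ 0 := by exact_mod_cast (show n ≠ 0 by omega)
  field_simp

/-- On the diagonal, a step in l takes 0 to -1, and the following step in n takes -1 back to 0. -/
theorem gaussTwo_self {n : ℕ} (hn : 1 ≤ n) : gaussTwo n n = 0 := by
  induction n, hn using Nat.le_induction with
  | base => exact gaussTwo_one_one
  | succ n hn ih =>
    have h1 := gaussTwo_succ_left hn hn
    have h2 := gaussTwo_succ_right (show 1 ≤ n + 1 by omega) hn
    have h6 : (n : ℝ) ≠ 0 := by exact_mod_cast (show n ≠ 0 by omega)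
    have h3 : gaussTwo (n + 1) n = -1 := by
      rw [ih] at h1
      refine mul_left_cancel₀ (mul_ne_zero two_ne_zero h6) ?_
      linear_combination h1
    rw [h3] at h2
    simpa [h6] using h2

/-- The recursion in l telescopes: 2(i+1) r_{i+1} - 2i r_i = (m+2-i) r_i - (m+2+i). At M = m the
boundary term vanishes by `gaussTwo_self`. -/
theorem sum_mul_gaussTwo (m M : ℕ) :
    ∑ i ∈ Finset.range M, ((m : ℝ) + 2 - i) * gaussTwo (i + 1) (m + 1)
      = ∑ i ∈ Finset.range M, ((m : ℝ) + 2 + i) + 2 * M * gaussTwo (M + 1) (m + 1) := by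
  induction M with
  | zero => simp
  | succ M ih =>
    rw [Finset.sum_range_succ, ih, Finset.sum_range_succ]
    have h := gaussTwo_succ_left (show 1 ≤ M + 1 by omega) (show 1 ≤ m + 1 by omega)
    push_cast at h ⊢
    linear_combination -h

theorem sum_gaussTwo (m : ℕ) :
    ∑ i ∈ Finset.range m, gaussTwo (i + 1) (m + 1)
      = ((m : ℝ) + 1) * ((harmonic (m + 1) : ℝ) - 1) := by
  induction m with
  | zero => simp
  | succ m ih =>
    have hs : gaussTwo (m + 1) (m + 1) = 0 := gaussTwo_self (by omega)
    have h1 := sum_mul_gaussTwo m m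
    rw [hs, mul_zero, add_zero] at h1
    have h2 : 2 * ((m : ℝ) + 1) * ∑ i ∈ Finset.range (m + 1), gaussTwo (i + 1) (m + 1 + 1)
        = ∑ i ∈ Finset.range (m + 1), ((m : ℝ) + 2 + i) * (gaussTwo (i + 1) (m + 1) + 1) := by
      rw [Finset.mul_sum]
      refine Finset.sum_congr rfl fun i _ => ?_
      have h := gaussTwo_succ_right (show 1 ≤ i + 1 by omega) (show 1 ≤ m + 1 by omega)
      push_cast at h ⊢
      linear_combination h
    -- Writing m+2+i = 2(m+2) - (m+2-i) lets the telescoped identity `h1` remove the weights.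
    have h3 : ∑ i ∈ Finset.range m, ((m : ℝ) + 2 + i) * (gaussTwo (i + 1) (m + 1) + 1)
        = 2 * ((m : ℝ) + 2) * ∑ i ∈ Finset.range m, gaussTwo (i + 1) (m + 1) := by
      have : ∀ i : ℕ, ((m : ℝ) + 2 + i) * (gaussTwo (i + 1) (m + 1) + 1)
          = 2 * ((m : ℝ) + 2) * gaussTwo (i + 1) (m + 1)
            - ((m : ℝ) + 2 - i) * gaussTwo (i + 1) (m + 1) + ((m : ℝ) + 2 + i) :=
        fun i => by ring
      simp only [this, Finset.sum_add_distrib, Finset.sum_sub_distrib, ← Finset.mul_sum, h1]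
      ring
    rw [Finset.sum_range_succ (fun i : ℕ => ((m : ℝ) + 2 + i) * _), h3, ih, hs] at h2
    have h4 : (m : ℝ) + 1 ≠ 0 := by positivity
    refine mul_left_cancel₀ (mul_ne_zero two_ne_zero h4) ?_
    rw [h2, harmonic_succ (m + 1)]
    push_cast
    field_simp
    ring

/-! ### The exponential integral -/

/-- `∑ x ^ k / (k * k!)`, `k ≥ 1`. -/
noncomputable def einFun (x : ℝ) : ℝ := ∑' k, coeff k einSeries * x ^ k

theorem summable_einSeries (x : ℝ) : Summable fun k => coeff k einSeries * x ^ k := by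
  refine Summable.of_norm_bounded (Real.summable_pow_div_factorial |x|) fun k => ?_
  rw [norm_mul, norm_pow, Real.norm_eq_abs, Real.norm_eq_abs, mul_comm, div_eq_mul_inv]
  refine mul_le_mul_of_nonneg_left ?_ (by positivity)
  rw [einSeries, coeff_mk, abs_of_nonneg (by positivity), one_div]
  rcases Nat.eq_zero_or_pos k with rfl | hk
  · simp
  · refine inv_anti₀ (by positivity) (le_mul_of_one_le_left (by positivity) ?_)
    exact_mod_cast hk

theorem hasSum_einSeries (x : ℝ) : HasSum (fun k => coeff k einSeries * x ^ k) (einFun x) :=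
  (summable_einSeries x).hasSum

theorem hasSum_expQuot {x : ℝ} (hx : x ≠ 0) :
    HasSum (fun k => coeff k expQuot * x ^ k) ((Real.exp x - 1) / x) := by
  have h : HasSum (fun k : ℕ => x ^ k / (k.factorial : ℝ)) (Real.exp x) := by
    rw [Real.exp_eq_exp_ℝ]; exact NormedSpace.expSeries_div_hasSum_exp x
  have h1 := ((hasSum_nat_add_iff' 1).2 h).div_const x
  simp only [Finset.sum_range_one, pow_zero, Nat.factorial_zero, Nat.cast_one, div_one] at h1
  refine h1.congr_fun fun k => ?_
  simp only [expQuot, coeff_mk]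
  field_simp
  ring

theorem hasDerivAt_einFun_tsum (x : ℝ) :
    HasDerivAt einFun (∑' k, coeff k einSeries * (k * x ^ (k - 1))) x := by
  have hx : x ∈ Metric.ball (0 : ℝ) (|x| + 1) := by simp
  refine hasDerivAt_tsum_of_isPreconnected (Real.summable_pow_div_factorial (|x| + 1))
    Metric.isOpen_ball (convex_ball _ _).isPreconnected
    (fun k y _ => (hasDerivAt_pow k y).const_mul _) (fun k y hy => ?_) hx (summable_einSeries x) hx
  rw [← mul_assoc, norm_mul, norm_pow, div_eq_mul_inv, mul_comm]
  have hy' : ‖y‖ ≤ |x| + 1 := (by simpa using hy : ‖y‖ < |x| + 1).le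
  refine mul_le_mul ?_ ?_ (norm_nonneg _) (by positivity)
  · exact (pow_le_pow_left₀ (norm_nonneg _) hy' _).trans
      (pow_le_pow_right₀ (by linarith [abs_nonneg x]) (Nat.sub_le _ _))
  · rw [einSeries, coeff_mk, Real.norm_of_nonneg (by positivity)]
    rcases Nat.eq_zero_or_pos k with rfl | hk
    · simp
    · rw [← one_div]; apply le_of_eq; field_simp

theorem hasDerivAt_einFun {x : ℝ} (hx : x ≠ 0) : HasDerivAt einFun ((Real.exp x - 1) / x) x := by
  convert hasDerivAt_einFun_tsum x using 1
  refine (HasSum.tsum_eq ((hasSum_nat_add_iff' 1).1 ?_)).symm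
  simp only [Finset.sum_range_one, Nat.cast_zero, zero_mul, mul_zero, sub_zero]
  refine (hasSum_expQuot hx).congr_fun fun k => ?_
  rw [← derivative_einSeries, coeff_derivative]
  push_cast
  exact (mul_assoc _ _ _).symm

theorem continuous_einFun : Continuous einFun :=
  continuous_iff_continuousAt.2 fun x => (hasDerivAt_einFun_tsum x).continuousAt

theorem einFun_zero : einFun 0 = 0 := by
  rw [einFun, tsum_eq_single 0 fun k hk => by simp [hk]]
  simp [einSeries]

/-- This is Γ'(1) = -γ, with Euler's integral differentiated under the integral sign. -/
theorem integral_exp_neg_mul_log :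
    ∫ t in Set.Ioi (0 : ℝ), Real.exp (-t) * Real.log t = -Real.eulerMascheroniConstant := by
  have h1 := Complex.hasDerivAt_GammaIntegral (s := 1) (by simp)
  have h2 : HasDerivAt Complex.GammaIntegral (-(Real.eulerMascheroniConstant : ℂ)) 1 := by
    refine Complex.hasDerivAt_Gamma_one.congr_of_eventuallyEq ?_
    filter_upwards [(isOpen_lt continuous_const Complex.continuous_re).mem_nhds
      (show (0 : ℝ) < (1 : ℂ).re by simp)] with s hs
    exact (Complex.Gamma_eq_integral hs).symm
  have h3 := h1.unique h2
  have h4 : ∫ t : ℝ in Set.Ioi 0, (t : ℂ) ^ ((1 : ℂ) - 1) * (Real.log t * Real.exp (-t))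
      = ((∫ t in Set.Ioi (0 : ℝ), Real.exp (-t) * Real.log t : ℝ) : ℂ) := by
    rw [← integral_complex_ofReal]
    refine integral_congr_ae (Eventually.of_forall fun t => ?_)
    simp [mul_comm]
  rw [h4] at h3
  exact_mod_cast h3

theorem integrableOn_exp_neg_mul_log :
    IntegrableOn (fun t => Real.exp (-t) * Real.log t) (Set.Ioi (0 : ℝ)) := by
  -- A non-integrable function has integral 0 by convention, whereas this integral is -γ < -1/2.
  by_contra h
  have h1 := integral_exp_neg_mul_log
  rw [integral_undef h] at h1
  have := Real.one_half_lt_eulerMascheroniConstant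
  linarith

/-- An antiderivative of `exp t / t`. -/
noncomputable def eiPrimitive (t : ℝ) : ℝ := Real.log t + einFun t

theorem hasDerivAt_eiPrimitive {x : ℝ} (hx : x ≠ 0) :
    HasDerivAt eiPrimitive (Real.exp x / x) x := by
  refine ((Real.hasDerivAt_log hx).add (hasDerivAt_einFun hx)).congr_deriv ?_
  field_simp
  ring

theorem hasDerivAt_eiPrimitive_neg_sub {t : ℝ} (ht : 0 < t) :
    HasDerivAt (fun t => eiPrimitive (-t) - Real.exp (-t) * Real.log t)
      (Real.exp (-t) * Real.log t) t := by
  have h1 := (hasDerivAt_eiPrimitive (neg_ne_zero.2 ht.ne')).comp t (hasDerivAt_neg t)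
  have h2 := ((Real.hasDerivAt_exp (-t)).comp t (hasDerivAt_neg t)).mul
    (Real.hasDerivAt_log ht.ne')
  refine (h1.sub h2).congr_deriv ?_
  simp only [Function.comp_apply]
  field_simp
  ring

theorem continuousWithinAt_eiPrimitive_neg_sub :
    ContinuousWithinAt (fun t => eiPrimitive (-t) - Real.exp (-t) * Real.log t) (Set.Ici 0) 0 := by
  have e : (fun t => eiPrimitive (-t) - Real.exp (-t) * Real.log t)
      = fun t => (1 - Real.exp (-t)) * Real.log t + einFun (-t) := by
    funext t; rw [eiPrimitive, Real.log_neg_eq_log]; ring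
  rw [e]
  refine ContinuousWithinAt.add ?_ (continuous_einFun.comp continuous_neg).continuousWithinAt
  have h := Real.continuous_mul_log.norm.tendsto 0
  simp only [zero_mul, norm_zero] at h
  rw [ContinuousWithinAt, Real.log_zero, mul_zero]
  refine squeeze_zero_norm' ?_ (h.mono_left nhdsWithin_le_nhds)
  filter_upwards [self_mem_nhdsWithin] with t ht
  have ht : 0 ≤ t := ht
  rw [norm_mul, norm_mul]
  refine mul_le_mul_of_nonneg_right ?_ (norm_nonneg _)
  rw [Real.norm_of_nonneg ht, Real.norm_of_nonneg]
  · linarith [Real.add_one_le_exp (-t)]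
  · rw [sub_nonneg, Real.exp_le_one_iff]; linarith

/-- Integration by parts shows that `eiPrimitive (-t)` minus e^{-t} ln t is an antiderivative of
e^{-t} ln t. It starts from 0 at t = 0, so its limit at infinity is -γ, and e^{-t} ln t itself tends
to 0. -/
theorem tendsto_eiPrimitive_atBot :
    Tendsto eiPrimitive atBot (𝓝 (-Real.eulerMascheroniConstant)) := by
  have hd : ∀ t ∈ Set.Ioi (0 : ℝ), HasDerivAt
      (fun t => eiPrimitive (-t) - Real.exp (-t) * Real.log t)
      (Real.exp (-t) * Real.log t) t := fun t ht => hasDerivAt_eiPrimitive_neg_sub ht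
  have h1 := tendsto_limUnder_of_hasDerivAt_of_integrableOn_Ioi hd integrableOn_exp_neg_mul_log
  have h2 := integral_Ioi_of_hasDerivAt_of_tendsto continuousWithinAt_eiPrimitive_neg_sub hd
    integrableOn_exp_neg_mul_log h1
  rw [integral_exp_neg_mul_log] at h2
  -- The convention `Real.log 0 = 0` gives the endpoint value 0, which is also the one-sided limit,
  -- because (1 - e^{-t}) ln t tends to 0.
  simp only [neg_zero, eiPrimitive, Real.log_zero, einFun_zero, mul_zero, add_zero, sub_zero] at h2
  have h3 : Tendsto (fun t : ℝ => Real.exp (-t) * Real.log t) atTop (𝓝 0) := by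
    have := Real.tendsto_pow_mul_exp_neg_atTop_nhds_zero 1
    refine squeeze_zero' ?_ ?_ this
    · filter_upwards [eventually_ge_atTop 1] with t ht
      exact mul_nonneg (Real.exp_pos _).le (Real.log_nonneg ht)
    · filter_upwards [eventually_ge_atTop 1] with t ht
      rw [pow_one, mul_comm]
      refine mul_le_mul_of_nonneg_right ?_ (Real.exp_pos _).le
      linarith [Real.log_le_sub_one_of_pos (show 0 < t by linarith)]
  have h4 := (h1.add h3).comp tendsto_neg_atBot_atTop
  simp only [eiPrimitive] at h4
  rw [← h2, add_zero] at h4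
  refine h4.congr fun t => ?_
  simp [eiPrimitive]

theorem integrableOn_exp_div_Iic {a : ℝ} (ha : a < 0) :
    IntegrableOn (fun t => Real.exp t / t) (Set.Iic a) := by
  have h := (integrableOn_exp_Iic a).div_const (-a)
  refine Integrable.mono' h ?_ ?_
  · exact (Real.measurable_exp.div measurable_id).aestronglyMeasurable
  · filter_upwards [ae_restrict_mem measurableSet_Iic] with t ht
    have ht : t ≤ a := ht
    rw [norm_div, Real.norm_of_nonneg (Real.exp_pos t).le, Real.norm_eq_abs,
      abs_of_neg (by linarith)]
    exact div_le_div_of_nonneg_left (Real.exp_pos t).le (by linarith) (by linarith)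

theorem integral_exp_div_Iic {a : ℝ} (ha : a < 0) :
    ∫ t in Set.Iic a, Real.exp t / t = eiPrimitive a + Real.eulerMascheroniConstant := by
  rw [integral_Iic_of_hasDerivAt_of_tendsto'
    (fun t ht => hasDerivAt_eiPrimitive (lt_of_le_of_lt ht ha).ne) (integrableOn_exp_div_Iic ha)
    tendsto_eiPrimitive_atBot]
  ring

theorem integral_exp_div_Iic_diff {x ε : ℝ} (hε : 0 < ε) (hx : ε < x) :
    ∫ t in Set.Iic x \ Set.Ioo (-ε) ε, Real.exp t / t
      = eiPrimitive x + Real.eulerMascheroniConstant + (einFun (-ε) - einFun ε) := by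
  have hset : Set.Iic x \ Set.Ioo (-ε) ε = Set.Iic (-ε) ∪ Set.Icc ε x := by
    ext t
    simp only [Set.mem_sdiff, Set.mem_Iic, Set.mem_Ioo, Set.mem_union, Set.mem_Icc, not_and, not_lt]
    constructor
    · rintro ⟨h1, h2⟩
      rcases le_or_gt t (-ε) with h | h
      · exact Or.inl h
      · exact Or.inr ⟨h2 h, h1⟩
    · rintro (h | h)
      · exact ⟨by linarith, fun h' => by linarith⟩
      · exact ⟨h.2, fun _ => h.1⟩
  have hdisj : Disjoint (Set.Iic (-ε)) (Set.Icc ε x) := by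
    rw [Set.disjoint_left]
    intro t h1 h2
    have h1 : t ≤ -ε := h1
    linarith [h2.1]
  have hne : ∀ t ∈ Set.uIcc ε x, t ≠ 0 := fun t ht => by
    rw [Set.uIcc_of_le hx.le] at ht
    linarith [ht.1, hε] |> fun h : 0 < t => h.ne'
  have hint : IntervalIntegrable (fun t => Real.exp t / t) volume ε x :=
    (ContinuousOn.div Real.continuous_exp.continuousOn continuousOn_id hne).intervalIntegrable
  have hI := intervalIntegral.integral_eq_sub_of_hasDerivAt
    (fun t ht => hasDerivAt_eiPrimitive (hne t ht)) hint
  rw [hset, setIntegral_union hdisj measurableSet_Icc (integrableOn_exp_div_Iic (by linarith))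
    ((intervalIntegrable_iff_integrableOn_Icc_of_le hx.le).1 hint), integral_exp_div_Iic
    (by linarith), integral_Icc_eq_integral_Ioc, ← intervalIntegral.integral_of_le hx.le, hI]
  simp only [eiPrimitive, Real.log_neg_eq_log]
  ring

/-- For x < 0 the excised interval eventually misses the domain. For x > 0 the logarithms at -ε and
ε cancel, leaving `einFun (-ε) - einFun ε`, which tends to 0. -/
theorem Ei_eq {x : ℝ} (hx : x ≠ 0) :
    Ei x = Real.eulerMascheroniConstant + Real.log |x| + einFun x := by
  rw [Ei, Real.log_abs]
  refine Tendsto.limUnder_eq ?_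
  rcases lt_or_gt_of_ne hx with hx | hx
  · refine tendsto_const_nhds.congr' ?_
    filter_upwards [Ioo_mem_nhdsGT (show (0 : ℝ) < -x by linarith)] with ε hε
    have : Set.Iic x \ Set.Ioo (-ε) ε = Set.Iic x := by
      refine sdiff_eq_left.2 (Set.disjoint_left.2 fun t h1 h2 => ?_)
      have h1 : t ≤ x := h1
      linarith [h2.1, hε.2]
    rw [this, integral_exp_div_Iic hx, eiPrimitive]
    ring
  · have h1 : Tendsto (fun ε => einFun (-ε) - einFun ε) (𝓝[>] 0) (𝓝 0) := by
      have : Continuous fun ε => einFun (-ε) - einFun ε :=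
        (continuous_einFun.comp continuous_neg).sub continuous_einFun
      simpa using (this.tendsto 0).mono_left (nhdsWithin_le_nhds (s := Set.Ioi 0))
    have h2 := h1.const_add (eiPrimitive x + Real.eulerMascheroniConstant)
    rw [add_zero, show eiPrimitive x + Real.eulerMascheroniConstant
      = Real.eulerMascheroniConstant + Real.log x + einFun x by rw [eiPrimitive]; ring] at h2
    refine h2.congr' ?_
    filter_upwards [Ioo_mem_nhdsGT hx] with ε hε
    rw [integral_exp_div_Iic_diff hε.1 hε.2, eiPrimitive]
    ring

/-! ### From formal series to functions -/

theorem hasSum_coeff_mul {f g : ℝ⟦X⟧} {x a b : ℝ} (hf : HasSum (fun k => coeff k f * x ^ k) a)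
    (hg : HasSum (fun k => coeff k g * x ^ k) b) :
    HasSum (fun k => coeff k (f * g) * x ^ k) (a * b) := by
  have e : (fun k => coeff k (f * g) * x ^ k)
      = fun k => ∑ p ∈ Finset.HasAntidiagonal.antidiagonal k,
        (coeff p.1 f * x ^ p.1) * (coeff p.2 g * x ^ p.2) := by
    funext k
    rw [coeff_mul, Finset.sum_mul]
    refine Finset.sum_congr rfl fun p hp => ?_
    rw [← Finset.HasAntidiagonal.mem_antidiagonal.1 hp, pow_add]; ring
  rw [e, ← hf.tsum_eq, ← hg.tsum_eq,
    tsum_mul_tsum_eq_tsum_sum_antidiagonal_of_summable_norm hf.summable.norm hg.summable.norm]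
  exact (summable_norm_sum_mul_antidiagonal_of_summable_norm
    hf.summable.norm hg.summable.norm).of_norm.hasSum

theorem hasSum_coeff_C_mul {f : ℝ⟦X⟧} {x a : ℝ} (c : ℝ)
    (hf : HasSum (fun k => coeff k f * x ^ k) a) :
    HasSum (fun k => coeff k (C c * f) * x ^ k) (c * a) := by
  simpa only [coeff_C_mul, mul_assoc] using hf.mul_left c

theorem hasSum_coeff_add {f g : ℝ⟦X⟧} {x a b : ℝ} (hf : HasSum (fun k => coeff k f * x ^ k) a)
    (hg : HasSum (fun k => coeff k g * x ^ k) b) :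
    HasSum (fun k => coeff k (f + g) * x ^ k) (a + b) := by
  simpa only [map_add, add_mul] using hf.add hg

theorem hasSum_coeff_sub {f g : ℝ⟦X⟧} {x a b : ℝ} (hf : HasSum (fun k => coeff k f * x ^ k) a)
    (hg : HasSum (fun k => coeff k g * x ^ k) b) :
    HasSum (fun k => coeff k (f - g) * x ^ k) (a - b) := by
  simpa only [map_sub, sub_mul] using hf.sub hg

theorem hasSum_coeff_sum {ι : Type*} {s : Finset ι} {f : ι → ℝ⟦X⟧} {x : ℝ} {a : ι → ℝ}
    (hf : ∀ i ∈ s, HasSum (fun k => coeff k (f i) * x ^ k) (a i)) :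
    HasSum (fun k => coeff k (∑ i ∈ s, f i) * x ^ k) (∑ i ∈ s, a i) := by
  simpa only [map_sum, Finset.sum_mul] using hasSum_sum hf

theorem hasSum_coeff_C (c x : ℝ) : HasSum (fun k => coeff k (C c : ℝ⟦X⟧) * x ^ k) c := by
  have := hasSum_single (f := fun k => coeff k (C c : ℝ⟦X⟧) * x ^ k) 0
    fun k hk => by simp [coeff_C, hk]
  simpa using this

theorem hasSum_coeff_exp (x : ℝ) :
    HasSum (fun k => coeff k (exp ℝ) * x ^ k) (Real.exp x) := by
  have h : HasSum (fun k : ℕ => x ^ k / (k.factorial : ℝ)) (Real.exp x) := by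
    rw [Real.exp_eq_exp_ℝ]; exact NormedSpace.expSeries_div_hasSum_exp x
  refine h.congr_fun fun k => ?_
  rw [coeff_exp]
  simp
  ring

theorem hasSum_kummerPoly (i : ℕ) (x : ℝ) :
    HasSum (fun k => coeff k (kummerPoly i) * x ^ k) (laguerre i 1 x / ((i : ℝ) + 1)) := by
  have h : laguerre i 1 x / ((i : ℝ) + 1)
      = ∑ k ∈ Finset.range (i + 1), coeff k (kummerPoly i) * x ^ k := by
    rw [laguerre, Finset.sum_div]
    refine Finset.sum_congr rfl fun j hj => ?_
    have hj : j ≤ i := by have := Finset.mem_range.1 hj; omega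
    have h1 := factorial_mul_ascPochhammer ℝ (j + 1) (i - j)
    rw [show j + 1 + (i - j) = i + 1 by omega, Nat.factorial_succ i] at h1
    have h2 := congrArg (Nat.cast (R := ℝ)) (Nat.choose_mul_factorial_mul_factorial hj)
    push_cast at h1 h2
    have h3 : (0 : ℝ) < (j + 1).factorial := by positivity
    have h4 : (0 : ℝ) < (i - j).factorial := by positivity
    have h5 : (0 : ℝ) < j.factorial := by positivity
    have h6 : (0 : ℝ) < (i : ℝ) + 1 := by positivity
    rw [← h2] at h1
    rw [kummerPoly, coeff_mk, neg_pow x]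
    field_simp
    linear_combination x ^ j * h1
  rw [h]
  refine hasSum_sum_of_ne_finset_zero fun k hk => ?_
  rw [kummerPoly, coeff_mk, Nat.choose_eq_zero_of_lt (by simpa using hk)]
  simp

/-! ### Differentiating ₁F₁(a; 2; x) in a -/

/-- The formal series of the `a`-derivative of `₁F₁(a; 2; x)` at `a = -m`. -/
noncomputable def kummerDeriv (m : ℕ) : ℝ⟦X⟧ :=
  mk fun k => (Polynomial.derivative (ascPochhammer ℝ k)).eval (-(m : ℝ))
    / (((k + 1).factorial : ℝ) * (k.factorial : ℝ))

theorem ascPochhammer_eval_neg_natCast (m k : ℕ) :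
    (ascPochhammer ℝ k).eval (-(m : ℝ)) = (-1) ^ k * m.choose k * k.factorial := by
  induction k with
  | zero => simp
  | succ k ih =>
    rw [ascPochhammer_succ_eval, ih, Nat.factorial_succ, pow_succ]
    push_cast
    linear_combination ((-1) ^ k * (k.factorial : ℝ)) * choose_succ_mul m k

/-- Coefficientwise this is the derivative in a of (a)_{k+1} = (a)_k (a+k), whose extra term (a)_k
at a = -m produces U_m. -/
theorem kummerOp_kummerDeriv (m : ℕ) : kummerOp m (kummerDeriv m) = kummerPoly m := by
  ext k
  have h : (Polynomial.derivative (ascPochhammer ℝ (k + 1))).eval (-(m : ℝ))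
      = (Polynomial.derivative (ascPochhammer ℝ k)).eval (-(m : ℝ)) * (-m + k)
        + (ascPochhammer ℝ k).eval (-(m : ℝ)) := by
    rw [ascPochhammer_succ_right]
    simp [Polynomial.derivative_mul]
  rw [ascPochhammer_eval_neg_natCast] at h
  rw [coeff_kummerOp]
  simp only [kummerDeriv, kummerPoly, coeff_mk, h]
  have h1 : ((k + 1 + 1).factorial : ℝ) = (k + 2) * (k + 1).factorial := by
    rw [Nat.factorial_succ (k + 1)]; push_cast; ring
  have h2 : ((k + 1).factorial : ℝ) = (k + 1) * k.factorial := by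
    rw [Nat.factorial_succ k]; push_cast; ring
  rw [h1, h2]
  field_simp
  ring

theorem coeff_zero_kummerDeriv (m : ℕ) : coeff 0 (kummerDeriv m) = 0 := by
  simp [kummerDeriv]

theorem norm_ascPochhammer_eval_le {a : ℂ} {M : ℝ} (hM : 1 ≤ M) (ha : ‖a‖ ≤ M) (k : ℕ) :
    ‖(ascPochhammer ℂ k).eval a‖ ≤ M ^ k * k.factorial := by
  induction k with
  | zero => simp
  | succ k ih =>
    rw [ascPochhammer_succ_eval, norm_mul, pow_succ, Nat.factorial_succ]
    have h : ‖a + k‖ ≤ M * (k + 1) := by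
      refine (norm_add_le _ _).trans ?_
      rw [Complex.norm_natCast]
      nlinarith [(Nat.cast_nonneg k : (0 : ℝ) ≤ k)]
    refine (mul_le_mul ih h (norm_nonneg _) (by positivity)).trans (le_of_eq ?_)
    push_cast; ring

theorem ascPochhammer_eval_two (k : ℕ) :
    (ascPochhammer ℂ k).eval (2 : ℂ) = ((k + 1).factorial : ℂ) := by
  have h := factorial_mul_ascPochhammer ℂ 1 k
  rw [Nat.factorial_one, Nat.cast_one, one_mul, one_add_one_eq_two, add_comm] at h
  exact h

/-- Weierstrass's theorem on the disc |a| < m+1: there |(a)_k| ≤ (m+1)ᵏ k! and (2)_k = (k+1)! ≥ k!,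
so an exponential series dominates and termwise differentiation is allowed. -/
theorem hasDerivAt_kummer (m : ℕ) (x : ℝ) :
    ∃ g : ℝ, HasSum (fun k => coeff k (kummerDeriv m) * x ^ k) g ∧
      HasDerivAt (fun a : ℂ => kummer a 2 x) (g : ℂ) (-(m : ℂ)) := by
  set F : ℕ → ℂ → ℂ := fun k a =>
    (ascPochhammer ℂ k).eval a / (ascPochhammer ℂ k).eval 2 * ((x : ℂ) ^ k / (k.factorial : ℂ))
    with hF
  have hu := Real.summable_pow_div_factorial (((m : ℝ) + 1) * |x|)
  have hmem : -(m : ℂ) ∈ Metric.ball (0 : ℂ) ((m : ℝ) + 1) := by simp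
  have hd : ∀ k, DifferentiableOn ℂ (F k) (Metric.ball 0 ((m : ℝ) + 1)) := fun k =>
    (((ascPochhammer ℂ k).differentiable.div_const _).mul_const _).differentiableOn
  have hb : ∀ k a, a ∈ Metric.ball (0 : ℂ) ((m : ℝ) + 1) →
      ‖F k a‖ ≤ (((m : ℝ) + 1) * |x|) ^ k / (k.factorial : ℝ) := by
    intro k a ha
    have ha : ‖a‖ ≤ (m : ℝ) + 1 := (by simpa using ha : ‖a‖ < (m : ℝ) + 1).le
    have h1 := norm_ascPochhammer_eval_le (by linarith [(Nat.cast_nonneg m : (0 : ℝ) ≤ m)]) ha k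
    simp only [hF]
    rw [ascPochhammer_eval_two, norm_mul, norm_div, norm_div, norm_pow, Complex.norm_natCast,
      Complex.norm_natCast, Complex.norm_real, Real.norm_eq_abs, mul_pow, mul_div_assoc]
    refine mul_le_mul_of_nonneg_right ?_ (by positivity)
    rw [div_le_iff₀ (by positivity)]
    refine h1.trans (mul_le_mul_of_nonneg_left ?_ (by positivity))
    exact_mod_cast Nat.factorial_le (Nat.le_succ k)
  have hs := Complex.hasSum_deriv_of_summable_norm hu hd Metric.isOpen_ball hb hmem
  have hD := ((Complex.differentiableOn_tsum_of_summable_norm hu hd Metric.isOpen_ball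
    hb).differentiableAt (Metric.isOpen_ball.mem_nhds hmem)).hasDerivAt
  have hderiv : ∀ k, deriv (F k) (-(m : ℂ)) = ((coeff k (kummerDeriv m) * x ^ k : ℝ) : ℂ) := by
    intro k
    have h := ((((ascPochhammer ℂ k).hasDerivAt (-(m : ℂ))).div_const
      ((ascPochhammer ℂ k).eval 2)).mul_const ((x : ℂ) ^ k / (k.factorial : ℂ))).deriv
    rw [hF, h, ascPochhammer_eval_two, kummerDeriv, coeff_mk,
      ← ascPochhammer_map (algebraMap ℝ ℂ), Polynomial.derivative_map,
      show -(m : ℂ) = algebraMap ℝ ℂ (-(m : ℝ)) by simp, Polynomial.eval_map_algebraMap,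
      Polynomial.aeval_algebraMap_apply]
    push_cast [Complex.coe_algebraMap, Polynomial.coe_aeval_eq_eval]
    field_simp
  simp only [hderiv] at hs
  have hsum := Complex.summable_ofReal.1 hs.summable
  refine ⟨_, hsum.hasSum, ?_⟩
  rw [Complex.ofReal_tsum, hs.tsum_eq]
  exact hD

/-! ### Assembling the formula -/

/-- Each summand is 2(m+1)/(m-i) - 1. -/
theorem sum_shift_div_eq_harmonic (m : ℕ) :
    ∑ i ∈ Finset.range m, ((m : ℝ) + 2 + i) / ((m : ℝ) - i)
      = 2 * ((m : ℝ) + 1) * (harmonic m : ℝ) - m := by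
  have h : (harmonic m : ℝ) = ∑ i ∈ Finset.range m, 1 / ((m : ℝ) - i) := by
    rw [harmonic, ← Finset.sum_range_reflect]
    push_cast
    refine Finset.sum_congr rfl fun i hi => ?_
    have hi := Finset.mem_range.1 hi
    rw [one_div, Nat.sub_sub, Nat.cast_sub (by omega)]
    push_cast
    congr 1; ring
  rw [h, Finset.mul_sum]
  have : (m : ℝ) = ∑ i ∈ Finset.range m, (1 : ℝ) := by simp
  conv_rhs => rw [this]
  rw [← Finset.sum_sub_distrib]
  refine Finset.sum_congr rfl fun i hi => ?_
  have hi : (m : ℝ) - i ≠ 0 := by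
    have := Finset.mem_range.1 hi
    rw [sub_ne_zero]; exact_mod_cast this.ne'
  rw [← this]
  field_simp
  ring

theorem kummer_deriv_eq {m : ℕ} {x g : ℝ} (hx : x ≠ 0)
    (hg : HasSum (fun k => coeff k (kummerDeriv m) * x ^ k) g) :
    ((m : ℝ) + 1) * g + (Real.exp x - 1) / x
      - ((harmonic (m + 1) : ℝ) + einFun x) * laguerre m 1 x
      + ∑ i ∈ Finset.range m, ((m : ℝ) + 2 + i) / ((m : ℝ) - i) * (laguerre i 1 x / ((i : ℝ) + 1))
      - Real.exp x * ∑ i ∈ Finset.range m,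
        gaussTwo (i + 1) (m + 1) * (laguerre i 1 x / ((i : ℝ) + 1)) = 0 := by
  have hm : (m : ℝ) + 1 ≠ 0 := by positivity
  have h := kummer_deriv_formal (m := m) (r := fun i => gaussTwo (i + 1) (m + 1))
    (H := (harmonic (m + 1) : ℝ)) (kummerOp_kummerDeriv m) (coeff_zero_kummerDeriv m)
    (fun i => by
      have h := gaussTwo_succ_left (show 1 ≤ i + 1 by omega) (show 1 ≤ m + 1 by omega)
      push_cast at h
      linear_combination h)
    (gaussTwo_self (by omega))
    -- The constant terms balance: what remains is H_{m+1} = H_m + 1/(m+1).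
    (by
      rw [sum_shift_div_eq_harmonic, sum_gaussTwo, harmonic_succ]
      push_cast
      field_simp
      ring)
  have hs := hasSum_coeff_sub (hasSum_coeff_add (hasSum_coeff_sub (hasSum_coeff_add
    (hasSum_coeff_C_mul ((m : ℝ) + 1) hg) (hasSum_expQuot hx))
    (hasSum_coeff_C_mul ((m : ℝ) + 1) (hasSum_coeff_mul (hasSum_coeff_add
      (hasSum_coeff_C (harmonic (m + 1) : ℝ) x) (hasSum_einSeries x)) (hasSum_kummerPoly m x))))
    (hasSum_coeff_sum (s := Finset.range m) fun i _ => hasSum_coeff_C_mul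
      (((m : ℝ) + 2 + i) / ((m : ℝ) - i)) (hasSum_kummerPoly i x)))
    (hasSum_coeff_mul (hasSum_coeff_exp x) (hasSum_coeff_sum (s := Finset.range m) fun i _ =>
      hasSum_coeff_C_mul (gaussTwo (i + 1) (m + 1)) (hasSum_kummerPoly i x)))
  rw [h] at hs
  simp only [map_zero, zero_mul] at hs
  rw [hs.unique hasSum_zero |>.symm]
  field_simp

theorem whittakerM_half (κ z : ℂ) :
    whittakerM κ (1 / 2) z = z * Complex.exp (-z / 2) * kummer (1 - κ) 2 z := by
  rw [whittakerM, add_halves, Complex.cpow_one, mul_one_div_cancel two_ne_zero, one_add_one_eq_two]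

theorem continuous_laguerre (n : ℕ) (α : ℝ) : Continuous (laguerre n α) := by
  unfold laguerre; fun_prop

theorem sum_Icc_one_eq_sum_range (m : ℕ) (f : ℕ → ℝ) :
    ∑ l ∈ Finset.Icc 1 m, f l = ∑ i ∈ Finset.range m, f (i + 1) := by
  rw [Finset.range_eq_Ico, Finset.sum_Ico_add' f 0 m 1]; rfl

theorem mainTheorem3 (n : ℕ) (hn : 1 ≤ n) :
    let D : ℝ → ℝ := fun x =>
      2 / (n : ℝ) * Real.sinh (x / 2) +
        x * Real.exp (-x / 2) / (n : ℝ) *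
          ((Real.log |x| + Real.eulerMascheroniConstant - (harmonic n : ℝ)
                - WhittakerDeriv.Ei x) * WhittakerDeriv.laguerre (n - 1) 1 x
            + ∑ ℓ ∈ Finset.Icc 1 (n - 1),
                (((n : ℝ) + (ℓ : ℝ)) / ((n : ℝ) - (ℓ : ℝ))
                    - Real.exp x *
                      (WhittakerDeriv.gaussF 1 (ℓ : ℂ) ((ℓ : ℂ) + (n : ℂ)) 2).re)
                  * (WhittakerDeriv.laguerre (ℓ - 1) 1 x / (ℓ : ℝ)))
    (∀ x : ℝ, x ≠ 0 →
      HasDerivAt (fun κ : ℂ => WhittakerDeriv.whittakerM κ (1 / 2) (x : ℂ)) ((D x : ℝ) : ℂ)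
        (n : ℂ)) ∧
    HasDerivAt (fun κ : ℂ => WhittakerDeriv.whittakerM κ (1 / 2) 0) 0 (n : ℂ) ∧
    Tendsto D (𝓝[≠] 0) (𝓝 0) := by
  intro D
  obtain ⟨m, rfl⟩ : ∃ m, n = m + 1 := ⟨n - 1, by omega⟩
  have hm : (m : ℝ) + 1 ≠ 0 := by positivity
  -- By `Ei_eq`, ln|x| + γ - Ei(x) = -`einFun x`; this form is continuous at 0 and also yields the
  -- limit there. The index is shifted by ℓ = i + 1.
  have hD : ∀ x : ℝ, x ≠ 0 → D x = 2 / ((m : ℝ) + 1) * Real.sinh (x / 2)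
      + x * Real.exp (-x / 2) / ((m : ℝ) + 1) *
        (-((harmonic (m + 1) : ℝ) + einFun x) * laguerre m 1 x
          + ∑ i ∈ Finset.range m, (((m : ℝ) + 2 + i) / ((m : ℝ) - i)
              - Real.exp x * gaussTwo (i + 1) (m + 1)) * (laguerre i 1 x / ((i : ℝ) + 1))) := by
    intro x hx
    simp only [D, Ei_eq hx, add_tsub_cancel_right, sum_Icc_one_eq_sum_range]
    push_cast
    congr 3
    · ring
    · refine Finset.sum_congr rfl fun i _ => ?_
      rw [gaussTwo]
      push_cast
      congr 3 <;> ring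
  refine ⟨fun x hx => ?_, ?_, ?_⟩
  · obtain ⟨g, hg, hgd⟩ := hasDerivAt_kummer m x
    -- The factor -1 comes from a = 1 - κ. The sinh term is x e^{-x/2} W/(m+1), the contribution of
    -- (eˣ-1)/x.
    have h1 : D x = x * Real.exp (-x / 2) * (g * -1) := by
      have h := kummer_deriv_eq hx hg
      have he : Real.exp x * Real.exp (-x / 2) = Real.exp (x / 2) := by
        rw [← Real.exp_add]; congr 1; ring
      rw [hD x hx, Real.sinh_eq, ← neg_div]
      have e : ∑ i ∈ Finset.range m, (((m : ℝ) + 2 + i) / ((m : ℝ) - i)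
              - Real.exp x * gaussTwo (i + 1) (m + 1)) * (laguerre i 1 x / ((i : ℝ) + 1))
          = ∑ i ∈ Finset.range m, ((m : ℝ) + 2 + i) / ((m : ℝ) - i)
              * (laguerre i 1 x / ((i : ℝ) + 1))
            - Real.exp x * ∑ i ∈ Finset.range m,
              gaussTwo (i + 1) (m + 1) * (laguerre i 1 x / ((i : ℝ) + 1)) := by
        rw [Finset.mul_sum, ← Finset.sum_sub_distrib]
        exact Finset.sum_congr rfl fun i _ => by ring
      rw [e, ← he]
      generalize (∑ i ∈ Finset.range m, ((m : ℝ) + 2 + i) / ((m : ℝ) - i)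
        * (laguerre i 1 x / ((i : ℝ) + 1))) = S at *
      generalize (∑ i ∈ Finset.range m,
        gaussTwo (i + 1) (m + 1) * (laguerre i 1 x / ((i : ℝ) + 1))) = T at *
      field_simp at h ⊢
      linear_combination h
    have h2 : HasDerivAt (fun κ : ℂ => kummer (1 - κ) 2 (x : ℂ)) ((g : ℂ) * -1)
        ((m + 1 : ℕ) : ℂ) := by
      have hp : (1 : ℂ) - ((m + 1 : ℕ) : ℂ) = -(m : ℂ) := by push_cast; ring
      rw [← hp] at hgd
      exact hgd.comp ((m + 1 : ℕ) : ℂ) ((hasDerivAt_id _).const_sub 1)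
    simp only [whittakerM_half]
    refine (h2.const_mul _).congr_deriv ?_
    rw [h1]
    push_cast
    rfl
  · simp only [whittakerM_half, zero_mul]
    exact hasDerivAt_const _ _
  · have hc : Continuous fun x : ℝ => 2 / ((m : ℝ) + 1) * Real.sinh (x / 2)
        + x * Real.exp (-x / 2) / ((m : ℝ) + 1) *
        (-((harmonic (m + 1) : ℝ) + einFun x) * laguerre m 1 x
          + ∑ i ∈ Finset.range m, (((m : ℝ) + 2 + i) / ((m : ℝ) - i)
              - Real.exp x * gaussTwo (i + 1) (m + 1)) * (laguerre i 1 x / ((i : ℝ) + 1))) := by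
      have h1 := continuous_einFun
      have h2 := fun i => continuous_laguerre i 1
      have h3 := Real.continuous_sinh
      fun_prop
    have h := (hc.tendsto 0).mono_left (nhdsWithin_le_nhds (s := {0}ᶜ))
    simp only [zero_div, Real.sinh_zero, mul_zero, zero_mul, add_zero] at h
    refine h.congr' ?_
    filter_upwards [self_mem_nhdsWithin] with x hx
    exact (hD x hx).symm
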